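/- Let $X$ be a real or complex locally convex topological vector space (not necessarily Hausdorff), let $C\subset X$ be a bounded convex set, and let $\rho_0$ be a continuous seminorm on $X$ such that $C$ is not $\rho_0$-totally bounded, i.e. for some $\varepsilon>0$ the set $C$ cannot be covered by finitely many $\rho_0$-balls of radius $\varepsilon$. Then there is a map $f\colon C\to C$ such that (1) $f$ has no approximate fixed point net, i.e. there is no net $(x_i)$ in $C$ with $x_i-f(x_i)\to 0$ in $X$; and (2) for every continuous seminorm $\rho$ on $X$, the map $f$ is $\rho_0$-to-$\rho$ Lipschitz, i.e. there is a constant $L\ge 0$ (which may depend on $\rho$) with $\rho(f(x)-f(y))\le L\,\rho_0(x-y)$ for all $x,y\in C$. -/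

import Mathlib

open Filter Topology

universe u v

/-- The set `C` is totally bounded with respect to the seminorm `ρ`: for each `ε > 0` it is covered
by finitely many open `ρ`-balls of radius `ε`. -/
def SeminormTotallyBounded {𝕜 : Type v} {X : Type u} [RCLike 𝕜] [AddCommGroup X] [Module 𝕜 X]
    (ρ : Seminorm 𝕜 X) (C : Set X) : Prop :=
  ∀ ε : ℝ, 0 < ε → ∃ t : Set X, t.Finite ∧ C ⊆ ⋃ y ∈ t, ρ.ball y ε

/-- The selfmap `f` of `C` is `ρ₀`-to-`ρ` Lipschitz. -/
def SeminormLipschitz {𝕜 : Type v} {X : Type u} [RCLike 𝕜] [AddCommGroup X] [Module 𝕜 X]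
    {C : Set X} (ρ₀ ρ : Seminorm 𝕜 X) (f : C → C) : Prop :=
  ∃ L : ℝ, 0 ≤ L ∧ ∀ x y : C, ρ ((f x : X) - (f y : X)) ≤ L * ρ₀ ((x : X) - (y : X))

/-- The selfmap `f` of `C` has an approximate fixed point net: there is a net `x i` in `C`, indexed
by a nonempty directed set, with `x i - f (x i) → 0`. -/
def HasApproxFixedPointNet {X : Type u} [AddCommGroup X] [TopologicalSpace X]
    {C : Set X} (f : C → C) : Prop :=
  ∃ (ι : Type u) (_ : Preorder ι) (_ : IsDirectedOrder ι) (_ : Nonempty ι) (x : ι → C),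
    Tendsto (fun i => (x i : X) - (f (x i) : X)) atTop (𝓝 0)

/-- A net indexed by a type in any universe gives `0 ∈ closure {x - f x : x ∈ C}`. -/
theorem zero_mem_closure_of_net {X : Type u} [AddCommGroup X] [TopologicalSpace X]
    {C : Set X} (f : C → C) {ι : Type v} [Preorder ι] [IsDirectedOrder ι] [Nonempty ι]
    (x : ι → C) (hx : Tendsto (fun i => (x i : X) - (f (x i) : X)) atTop (𝓝 0)) :
    (0 : X) ∈ closure (Set.range fun x : C => (x : X) - (f x : X)) :=
  mem_closure_of_tendsto hx (Eventually.of_forall fun i => ⟨x i, rfl⟩)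

/-- The universe of the index set in `HasApproxFixedPointNet` is harmless: index sets in the
universe of `X` already detect `0 ∈ closure {x - f x : x ∈ C}`. -/
theorem hasApproxFixedPointNet_iff {X : Type u} [AddCommGroup X] [TopologicalSpace X]
    {C : Set X} (f : C → C) :
    HasApproxFixedPointNet f ↔
      (0 : X) ∈ closure (Set.range fun x : C => (x : X) - (f x : X)) := by
  constructor
  · rintro ⟨ι, _, _, _, x, hx⟩
    exact zero_mem_closure_of_net f x hx
  · intro h
    have h' : ∀ U : {U : Set X // U ∈ 𝓝 (0 : X)}, ∃ x : C, (x : X) - (f x : X) ∈ U.1 := by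
      intro U
      obtain ⟨_, hU, x, rfl⟩ := mem_closure_iff_nhds.1 h U.1 U.2
      exact ⟨x, hU⟩
    choose x hx using h'
    refine ⟨({U : Set X // U ∈ 𝓝 (0 : X)})ᵒᵈ, inferInstance, ⟨fun U V => ?_⟩,
      ⟨OrderDual.toDual ⟨Set.univ, univ_mem⟩⟩, fun U => x (OrderDual.ofDual U), ?_⟩
    · exact ⟨OrderDual.toDual ⟨(OrderDual.ofDual U).1 ∩ (OrderDual.ofDual V).1,
        inter_mem (OrderDual.ofDual U).2 (OrderDual.ofDual V).2⟩,
        Set.inter_subset_left, Set.inter_subset_right⟩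
    · intro W hW
      rw [mem_map]
      refine mem_of_superset (mem_atTop (OrderDual.toDual ⟨W, hW⟩)) ?_
      intro V hV
      exact hV (hx (OrderDual.ofDual V))

/-! Fix `x₀` in `C`. Since `C` is not `ρ₀`-totally bounded, there are vectors `y n` with `x₀ + y n`
in `C`, each at `ρ₀`-distance at least a fixed `δ` from the span of its predecessors
(`exists_separated_seq`). The cone with apex `x₀` over the polygonal path through the points `x₀ + y
n` lies in `C` and has coordinates `(r, s)` in `[0, 1] × [0, ∞)`.

This cone is a Lipschitz retract in the following sense. A difference of two cone points involves at
most four of the `y n`, so its coefficients are controlled by `ρ₀` with one constant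
(`abs_coeff_le`). The hat coordinates therefore extend to `ρ₀`-Lipschitz functions on `X`; with a
doubled Lipschitz constant, the minimal extensions are still carried by two consecutive indices
(`coordExt_eq_zero_of_far`), so mass and barycenter turn them back into cone coordinates.

The abstract cone has a Lipschitz selfmap `coneMap` that moves every point by at least `1 / 64`. Let
`f` be the retraction followed by `coneMap`. The retraction fixes `f x`, so a small `ρ₀ (x - f x)`
would give a point of the cone that is hardly moved. Finally, `C` is bounded for every continuous
`ρ`, so the parametrization of the cone is Lipschitz from `coneDist` to `ρ`, and `f` is `ρ₀`-to-`ρ`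
Lipschitz. -/

/-! ### The abstract cone and a Lipschitz selfmap with displacement bounded below. -/

/-- The distance on the cone over the ray `[0, ∞)`; the point `(r, s)` has height `r` over the
apex and lies on the segment that joins the apex to `s`. -/
def coneDist (p q : ℝ × ℝ) : ℝ :=
  |p.1 - q.1| + min p.1 q.1 * min 1 |p.2 - q.2|

theorem coneDist_comm (p q : ℝ × ℝ) : coneDist p q = coneDist q p := by
  simp only [coneDist, abs_sub_comm, min_comm]

/-- The domain of the cone coordinates. -/
def coneSet : Set (ℝ × ℝ) := {p | 0 ≤ p.1 ∧ p.1 ≤ 1 ∧ 0 ≤ p.2}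

/-- The tent function with peak at `1 / 2`. -/
noncomputable def tent (r : ℝ) : ℝ := max 0 (1 - 4 * |r - 1 / 2|)

theorem tent_nonneg (r : ℝ) : 0 ≤ tent r := le_max_left _ _

theorem tent_le_one (r : ℝ) : tent r ≤ 1 :=
  max_le zero_le_one (by linarith [abs_nonneg (r - 1 / 2)])

theorem tent_le {r : ℝ} (hr : 0 ≤ r) : tent r ≤ 4 * r :=
  max_le (by linarith) (by linarith [neg_abs_le (r - 1 / 2)])

theorem abs_tent_sub_le (r r' : ℝ) : |tent r - tent r'| ≤ 4 * |r - r'| := by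
  unfold tent
  refine (abs_max_sub_max_le_max _ _ _ _).trans (max_le (by simp) ?_)
  have h := abs_abs_sub_abs_le (r' - 1 / 2) (r - 1 / 2)
  rw [show 1 - 4 * |r - 1 / 2| - (1 - 4 * |r' - 1 / 2|) =
    4 * (|r' - 1 / 2| - |r - 1 / 2|) by ring, abs_mul, abs_of_pos (by norm_num : (0 : ℝ) < 4)]
  rw [show r' - 1 / 2 - (r - 1 / 2) = r' - r by ring, abs_sub_comm r' r] at h
  linarith

/-- A selfmap of the cone without approximate fixed points. -/
noncomputable def coneMap (p : ℝ × ℝ) : ℝ × ℝ :=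
  (1 - min 1 p.2 * tent p.1,
    -- The jump across `r = 1 / 2` is harmless: for `s ≤ 1` both branches give `0` there, and for `s
    -- > 1` the image has height `0`, so it is the apex. The shift of `s` is `-1` for `1 / 2 < r ≤ 3
    -- / 4` (truncated at `0`) and rises to `+1` at `r = 1`.
    if p.1 ≤ 1 / 2 then 0 else max 0 (p.2 - 1 + 8 * max 0 (p.1 - 3 / 4)))

theorem coneMap_mem {p : ℝ × ℝ} (hp : p ∈ coneSet) : coneMap p ∈ coneSet := by
  obtain ⟨_, _, h3⟩ := hp
  have h0 : 0 ≤ min 1 p.2 := le_min zero_le_one h3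
  have h1 : min 1 p.2 ≤ 1 := min_le_left _ _
  have := tent_nonneg p.1
  have := tent_le_one p.1
  refine ⟨?_, ?_, ?_⟩
  · simp only [coneMap]; nlinarith
  · simp only [coneMap]; nlinarith
  · simp only [coneMap]; split_ifs
    · exact le_rfl
    · exact le_max_left _ _

/-- Either the height rises (`far`) or the position along the ray moves by `1 / 8` at a height of at
least `1 / 4` (`key`). The height rises where `tent` vanishes, except near the top, and where `s` is
small and `r ≤ 3 / 4`. Near the top `s` is pushed outward; in the middle band a larger `s` is pushed
inward. -/
theorem coneDist_coneMap_ge {p : ℝ × ℝ} (hp : p ∈ coneSet) :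
    1 / 64 ≤ coneDist p (coneMap p) := by
  obtain ⟨r, s⟩ := p
  obtain ⟨h1, h2, h3⟩ := hp
  obtain ⟨hR0, hR1, hS0⟩ := coneMap_mem (p := (r, s)) ⟨h1, h2, h3⟩
  simp only at h1 h2 h3
  have key : ∀ R S : ℝ, 0 ≤ R → 1 / 8 ≤ |s - S| → 1 / 4 ≤ r →
      1 / 64 ≤ |r - R| + min r R * min 1 |s - S| := by
    intro R S hR hS hr
    have hm : 1 / 8 ≤ min 1 |s - S| := le_min (by norm_num) hS
    -- If the image is near the apex, `min r R` is useless, but then the height drops by at least `1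
    -- / 8`.
    rcases le_total (1 / 8) R with h | h
    · have : 1 / 8 ≤ min r R := le_min (by linarith) h
      have := abs_nonneg (r - R)
      nlinarith
    · have : 0 ≤ min r R := le_min h1 hR
      have := le_abs_self (r - R)
      nlinarith
  have far : ∀ R S : ℝ, 0 ≤ R → r + 1 / 64 ≤ R →
      1 / 64 ≤ |r - R| + min r R * min 1 |s - S| := by
    intro R S hR h
    have : 0 ≤ min r R * min 1 |s - S| :=
      mul_nonneg (le_min h1 hR) (le_min zero_le_one (abs_nonneg _))
    have := neg_abs_le (r - R)
    linarith
  have ht0 := tent_nonneg r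
  have ht1 := tent_le_one r
  have hd0 : 0 ≤ min 1 s := le_min zero_le_one h3
  simp only [coneDist]
  by_cases hs : s ≤ 1 / 8 ∧ r ≤ 3 / 4
  · apply far _ _ hR0
    have : min 1 s ≤ 1 / 8 := (min_le_right _ _).trans hs.1
    simp only [coneMap]
    nlinarith
  by_cases hr : r ≤ 1 / 4
  · apply far _ _ hR0
    have : tent r = 0 := by
      unfold tent
      rw [abs_of_nonpos (by linarith)]
      exact max_eq_left (by linarith)
    simp only [coneMap, this]
    linarith
  by_cases hr2 : 3 / 4 < r
  · have htz : tent r = 0 := by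
      unfold tent
      rw [abs_of_nonneg (by linarith)]
      exact max_eq_left (by linarith)
    by_cases hr3 : r ≤ 15 / 16
    · apply far _ _ hR0
      simp only [coneMap, htz]
      linarith
    · apply key _ _ hR0 _ (by linarith)
      have : ¬ r ≤ 1 / 2 := by linarith
      simp only [coneMap, this, if_false]
      rw [max_eq_right (by linarith : (0 : ℝ) ≤ r - 3 / 4), max_eq_right (by linarith)]
      refine le_trans ?_ (neg_le_abs _)
      linarith
  · have hs' : 1 / 8 < s := by
      by_contra h
      exact hs ⟨by linarith, by linarith⟩
    apply key _ _ hR0 _ (by linarith)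
    simp only [coneMap]
    split_ifs with h
    · rw [sub_zero]; exact hs'.le.trans (le_abs_self _)
    · rw [max_eq_left (by linarith : r - 3 / 4 ≤ 0)]
      refine le_trans ?_ (le_abs_self _)
      rcases max_cases 0 (s - 1 + 8 * 0) with ⟨h, _⟩ | ⟨h, _⟩ <;> rw [h] <;> linarith

theorem coneDist_coneMap_le {p q : ℝ × ℝ} (hp : p ∈ coneSet) (hq : q ∈ coneSet) :
    coneDist (coneMap p) (coneMap q) ≤ 12 * coneDist p q := by
  wlog hpq : p.1 ≤ q.1 generalizing p q
  · rw [coneDist_comm, coneDist_comm p]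
    exact this hq hp (le_of_not_ge hpq)
  obtain ⟨hR0, hR1, hS0⟩ := coneMap_mem hp
  obtain ⟨hR0', hR1', hS0'⟩ := coneMap_mem hq
  obtain ⟨r, s⟩ := p
  obtain ⟨r', s'⟩ := q
  obtain ⟨h1, h2, h3⟩ := hp
  obtain ⟨h1', h2', h3'⟩ := hq
  simp only at h1 h2 h3 h1' h2' h3' hpq
  set m := min 1 |s - s'| with hm
  have hm0 : 0 ≤ m := le_min zero_le_one (abs_nonneg _)
  have hm1 : m ≤ 1 := min_le_left _ _
  have hD : coneDist (r, s) (r', s') = (r' - r) + r * m := by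
    simp only [coneDist, min_eq_left hpq, abs_sub_comm r, abs_of_nonneg (sub_nonneg.2 hpq), hm]
  have hrm : 0 ≤ r * m := mul_nonneg h1 hm0
  have hA : |(coneMap (r, s)).1 - (coneMap (r', s')).1| ≤ 4 * ((r' - r) + r * m) := by
    have hd : |min 1 s - min 1 s'| ≤ m := by
      refine le_min ?_ ?_
      · have := min_le_left 1 s
        have := min_le_left 1 s'
        have : 0 ≤ min 1 s := le_min zero_le_one h3
        have : 0 ≤ min 1 s' := le_min zero_le_one h3'
        rw [abs_le]; constructor <;> linarith
      · exact (abs_min_sub_min_le_max _ _ _ _).trans (max_le (by simp) le_rfl)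
    have e : (coneMap (r, s)).1 - (coneMap (r', s')).1 =
        -((min 1 s - min 1 s') * tent r + min 1 s' * (tent r - tent r')) := by
      simp only [coneMap]; ring
    rw [e, abs_neg]
    refine (abs_add_le _ _).trans ?_
    rw [abs_mul, abs_mul, abs_of_nonneg (tent_nonneg r),
      abs_of_nonneg (le_min zero_le_one h3' : (0 : ℝ) ≤ min 1 s')]
    have t1 := abs_tent_sub_le r r'
    rw [abs_sub_comm r, abs_of_nonneg (sub_nonneg.2 hpq)] at t1
    have t2 : |min 1 s - min 1 s'| * tent r ≤ m * (4 * r) :=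
      mul_le_mul hd (tent_le h1) (tent_nonneg r) hm0
    have t3 : min 1 s' * |tent r - tent r'| ≤ 1 * |tent r - tent r'| :=
      mul_le_mul_of_nonneg_right (min_le_left _ _) (abs_nonneg _)
    linarith
  have hB : min (coneMap (r, s)).1 (coneMap (r', s')).1 *
      min 1 |(coneMap (r, s)).2 - (coneMap (r', s')).2| ≤ 8 * ((r' - r) + r * m) := by
    have hmin0 := le_min hR0 hR0'
    have hmin1 : min (coneMap (r, s)).1 (coneMap (r', s')).1 ≤ 1 := (min_le_left _ _).trans hR1
    set w := min 1 |(coneMap (r, s)).2 - (coneMap (r', s')).2| with hw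
    have hw0 : 0 ≤ w := le_min zero_le_one (abs_nonneg _)
    have hw1 : w ≤ 1 := min_le_left _ _
    rcases le_or_gt r' (1 / 2) with hr' | hr'
    · have : w = 0 := by
        simp only [hw, coneMap, hr', hpq.trans hr', if_true]
        simp
      rw [this]
      linarith
    rcases lt_or_ge (1 / 2) r with hr | hr
    · have hS : w ≤ m + 8 * (r' - r) := by
        have e : |(coneMap (r, s)).2 - (coneMap (r', s')).2| ≤ |s - s'| + 8 * (r' - r) := by
          simp only [coneMap, not_le.2 hr, not_le.2 hr', if_false]
          refine (abs_max_sub_max_le_max _ _ _ _).trans (max_le ?_ ?_)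
          · rw [sub_zero, abs_zero]
            have := abs_nonneg (s - s')
            linarith
          · have := abs_max_sub_max_le_max 0 (r - 3 / 4) 0 (r' - 3 / 4)
            rw [sub_zero, abs_zero, sub_sub_sub_cancel_right, max_eq_right (abs_nonneg (r - r')),
              abs_sub_comm r, abs_of_nonneg (sub_nonneg.2 hpq)] at this
            rw [show s - 1 + 8 * max 0 (r - 3 / 4) - (s' - 1 + 8 * max 0 (r' - 3 / 4)) =
              (s - s') + 8 * (max 0 (r - 3 / 4) - max 0 (r' - 3 / 4)) by ring]
            refine (abs_add_le _ _).trans ?_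
            rw [abs_mul 8, abs_of_pos (by norm_num : (0 : ℝ) < 8)]
            linarith
        rcases le_total 1 |s - s'| with h | h
        · rw [hm, min_eq_left h]; linarith
        · rw [hm, min_eq_right h]; exact (min_le_right _ _).trans e
      nlinarith
    rcases le_or_gt (3 / 4) r' with hr3 | hr3
    -- Here `r' - r ≥ 1 / 4`, so the right side exceeds the trivial bound `1`.
    · nlinarith
    rcases le_or_gt s' 1 with hs | hs
    · have : w = 0 := by
        simp only [hw, coneMap, not_le.2 hr', hr, if_true, if_false]
        rw [max_eq_left (by linarith : r' - 3 / 4 ≤ 0), max_eq_left (by linarith)]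
        simp
      rw [this]
      linarith
    -- The second coordinate may jump here, but the image of `(r', s')` has height at most `4 * (r'
    -- - 1 / 2) ≤ 4 * (r' - r)`.
    · have : (coneMap (r', s')).1 ≤ 4 * (r' - 1 / 2) := by
        simp only [coneMap, min_eq_left hs.le, tent]
        rw [abs_of_pos (by linarith)]
        have := le_max_right 0 (1 - 4 * (r' - 1 / 2))
        linarith
      have := min_le_right (coneMap (r, s)).1 (coneMap (r', s')).1
      nlinarith
  rw [hD]
  simp only [coneDist]
  linarith

/-! ### Hat functions, polygonal paths and the geometry of the cone inside `X`. -/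

/-- The piecewise linear function on `ℝ` with value `1` at `n` and `0` at the other integers. -/
noncomputable def hat (n : ℕ) (s : ℝ) : ℝ := max 0 (1 - |s - n|)

theorem hat_nonneg (n : ℕ) (s : ℝ) : 0 ≤ hat n s := le_max_left _ _

theorem hat_le_one (n : ℕ) (s : ℝ) : hat n s ≤ 1 :=
  max_le zero_le_one (by linarith [abs_nonneg (s - n)])

theorem hat_eq_zero {n : ℕ} {s : ℝ} (h : 1 ≤ |s - n|) : hat n s = 0 :=
  max_eq_left (by linarith)

theorem abs_sub_lt_one_of_hat_pos {n : ℕ} {s : ℝ} (h : 0 < hat n s) : |s - n| < 1 := by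
  by_contra h'
  exact h.ne' (hat_eq_zero (not_lt.1 h'))

theorem abs_hat_sub_le (n : ℕ) (s t : ℝ) : |hat n s - hat n t| ≤ |s - t| := by
  unfold hat
  refine (abs_max_sub_max_le_max _ _ _ _).trans (max_le (by simp) ?_)
  rw [sub_sub_sub_cancel_left]
  refine (abs_abs_sub_abs_le _ _).trans ?_
  rw [sub_sub_sub_cancel_right, abs_sub_comm]

theorem hat_floor {s : ℝ} (hs : 0 ≤ s) : hat ⌊s⌋₊ s = 1 - (s - ⌊s⌋₊) := by
  have h1 := Nat.floor_le hs
  have h2 := Nat.lt_floor_add_one s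
  rw [hat, abs_of_nonneg (by linarith), max_eq_right (by linarith)]

theorem hat_floor_add_one {s : ℝ} (hs : 0 ≤ s) : hat (⌊s⌋₊ + 1) s = s - ⌊s⌋₊ := by
  have h1 := Nat.floor_le hs
  have h2 := Nat.lt_floor_add_one s
  rw [hat]
  push_cast
  rw [abs_of_nonpos (by linarith), max_eq_right (by linarith)]
  ring

theorem hat_eq_zero_of_ne {s : ℝ} (hs : 0 ≤ s) {n : ℕ} (h1 : n ≠ ⌊s⌋₊) (h2 : n ≠ ⌊s⌋₊ + 1) :
    hat n s = 0 := by
  have h3 := Nat.floor_le hs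
  have h4 := Nat.lt_floor_add_one s
  apply hat_eq_zero
  rcases lt_or_gt_of_ne h1 with h | h
  · have : (n : ℝ) + 1 ≤ ⌊s⌋₊ := by exact_mod_cast h
    refine le_trans ?_ (le_abs_self _)
    linarith
  · have h5 : ⌊s⌋₊ + 2 ≤ n := by omega
    have : (⌊s⌋₊ : ℝ) + 2 ≤ n := by exact_mod_cast h5
    refine le_trans ?_ (neg_le_abs _)
    linarith

section Polygonal

variable {X : Type u} [AddCommGroup X] [Module ℝ X]

/-- The piecewise linear path through the points `y 0, y 1, y 2, …`. -/
noncomputable def polygonal (y : ℕ → X) (s : ℝ) : X :=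
  hat ⌊s⌋₊ s • y ⌊s⌋₊ + hat (⌊s⌋₊ + 1) s • y (⌊s⌋₊ + 1)

theorem polygonal_eq_sum (y : ℕ → X) {s : ℝ} (hs : 0 ≤ s) {F : Finset ℕ}
    (h1 : ⌊s⌋₊ ∈ F) (h2 : ⌊s⌋₊ + 1 ∈ F) : polygonal y s = ∑ n ∈ F, hat n s • y n := by
  rw [polygonal, ← Finset.sum_pair (f := fun n => hat n s • y n) (by omega : ⌊s⌋₊ ≠ ⌊s⌋₊ + 1)]
  refine Finset.sum_subset ?_ ?_
  · intro n hn
    rcases Finset.mem_insert.1 hn with rfl | hn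
    · exact h1
    · rwa [Finset.mem_singleton.1 hn]
  · intro n _ hn
    simp only [Finset.mem_insert, Finset.mem_singleton, not_or] at hn
    rw [hat_eq_zero_of_ne hs hn.1 hn.2, zero_smul]

/-- The floors of `s` and `t` and their successors: a set of indices that carries the
coordinates of both points of a polygonal path. -/
noncomputable def floorPair (s t : ℝ) : Finset ℕ := {⌊s⌋₊, ⌊s⌋₊ + 1, ⌊t⌋₊, ⌊t⌋₊ + 1}

theorem smul_polygonal_sub (y : ℕ → X) (r r' : ℝ) {s s' : ℝ} (hs : 0 ≤ s) (hs' : 0 ≤ s') :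
    r • polygonal y s - r' • polygonal y s' =
      ∑ n ∈ floorPair s s', (r * hat n s - r' * hat n s') • y n := by
  rw [polygonal_eq_sum y hs (F := floorPair s s') (by simp [floorPair]) (by simp [floorPair]),
    polygonal_eq_sum y hs' (F := floorPair s s') (by simp [floorPair]) (by simp [floorPair]),
    Finset.smul_sum, Finset.smul_sum, ← Finset.sum_sub_distrib]
  exact Finset.sum_congr rfl fun n _ => by rw [smul_smul, smul_smul, ← sub_smul]

theorem add_smul_polygonal_mem {C : Set X} (hC : Convex ℝ C) {x₀ : X} (hx₀ : x₀ ∈ C) {y : ℕ → X}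
    (hy : ∀ n, x₀ + y n ∈ C) {p : ℝ × ℝ} (hp : p ∈ coneSet) :
    x₀ + p.1 • polygonal y p.2 ∈ C := by
  obtain ⟨h1, h2, h3⟩ := hp
  have e : hat ⌊p.2⌋₊ p.2 + hat (⌊p.2⌋₊ + 1) p.2 = 1 := by
    rw [hat_floor h3, hat_floor_add_one h3]; ring
  have h := hC (hy ⌊p.2⌋₊) (hy (⌊p.2⌋₊ + 1)) (hat_nonneg _ _) (hat_nonneg _ _) e
  have h' := hC hx₀ h (sub_nonneg.2 h2) h1 (by ring)
  convert h' using 1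
  have e2 : hat ⌊p.2⌋₊ p.2 • (x₀ + y ⌊p.2⌋₊) + hat (⌊p.2⌋₊ + 1) p.2 • (x₀ + y (⌊p.2⌋₊ + 1)) =
      x₀ + polygonal y p.2 := by
    rw [polygonal, smul_add, smul_add, add_add_add_comm, ← add_smul, e, one_smul]
  rw [e2]
  module

theorem Seminorm.map_smul_real (ρ : Seminorm ℝ X) (c : ℝ) (x : X) : ρ (c • x) = |c| * ρ x := by
  rw [map_smul_eq_mul, Real.norm_eq_abs]

/-- If each `y n` has `ρ`-distance at least `δ` from the span of its predecessors, the
coefficients of a combination of at most `k` vectors `y n` are controlled by its seminorm. -/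
theorem abs_coeff_le (ρ : Seminorm ℝ X) {y : ℕ → X} {δ M : ℝ} (hδ : 0 < δ)
    {N : ℕ} (hM : ∀ n < N, ρ (y n) ≤ M)
    (hy : ∀ n < N, ∀ c : ℕ → ℝ, δ ≤ ρ (y n - ∑ i ∈ Finset.range n, c i • y i))
    (F : Finset ℕ) : (∀ n ∈ F, n < N) → ∀ (c : ℕ → ℝ), ∀ n ∈ F,
      |c n| ≤ δ⁻¹ * (1 + M / δ) ^ F.card * ρ (∑ i ∈ F, c i • y i) := by
  induction F using Finset.induction_on_max with
  | empty => simp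
  | insert m F hmax ih =>
    intro hN c n hn
    have hmF : m ∉ F := fun h => lt_irrefl _ (hmax m h)
    have hmN := hN m (Finset.mem_insert_self _ _)
    have hM0 : 0 ≤ M := (apply_nonneg ρ _).trans (hM m hmN)
    have hA : 1 ≤ 1 + M / δ := by
      have := div_nonneg hM0 hδ.le
      linarith
    rw [Finset.sum_insert hmF, Finset.card_insert_of_notMem hmF]
    set V := ∑ i ∈ F, c i • y i with hV
    set R := ρ (c m • y m + V) with hR
    have hR0 : 0 ≤ R := apply_nonneg ρ _
    have hm : |c m| ≤ δ⁻¹ * R := by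
      rw [inv_mul_eq_div, le_div_iff₀ hδ]
      by_cases h0 : c m = 0
      · simpa [h0] using hR0
      -- The largest index `m` carries the separation: after division by `c m`, the other terms form
      -- a combination of predecessors of `y m`.
      have h := hy m hmN (fun i => if i ∈ F then -((c m)⁻¹ * c i) else 0)
      have e : ∑ i ∈ Finset.range m, (if i ∈ F then -((c m)⁻¹ * c i) else 0) • y i =
          -((c m)⁻¹ • V) := by
        rw [hV, Finset.smul_sum, ← Finset.sum_neg_distrib]
        symm
        refine Finset.sum_subset_zero_on_sdiff (fun i hi => Finset.mem_range.2 (hmax i hi)) ?_ ?_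
        · intro i hi
          simp [(Finset.mem_sdiff.1 hi).2]
        · intro i hi
          simp only [hi, if_true, neg_smul, smul_smul]
      rw [e, sub_neg_eq_add] at h
      have e2 : c m • y m + V = c m • (y m + (c m)⁻¹ • V) := by
        rw [smul_add, smul_smul, mul_inv_cancel₀ h0, one_smul]
      rw [hR, e2, ρ.map_smul_real]
      exact mul_le_mul_of_nonneg_left h (abs_nonneg _)
    have hone : 1 ≤ (1 + M / δ) ^ (F.card + 1) := one_le_pow₀ hA
    rcases Finset.mem_insert.1 hn with rfl | hn
    · refine hm.trans ?_
      rw [mul_right_comm]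
      exact le_mul_of_one_le_right (mul_nonneg (inv_nonneg.2 hδ.le) hR0) hone
    -- Removing the top term enlarges the seminorm by a factor of at most `1 + M / δ`; one such
    -- factor per index makes the constant depend on `F` only through its cardinality.
    · refine (ih (fun i hi => hN i (Finset.mem_insert_of_mem hi)) c n hn).trans ?_
      rw [pow_succ, ← mul_assoc, mul_assoc _ (1 + M / δ)]
      refine mul_le_mul_of_nonneg_left ?_
        (mul_nonneg (inv_nonneg.2 hδ.le) (pow_nonneg (zero_le_one.trans hA) _))
      calc ρ V = ρ ((c m • y m + V) - c m • y m) := by rw [add_sub_cancel_left]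
        _ ≤ R + |c m| * ρ (y m) := by
          rw [← ρ.map_smul_real]; exact map_sub_le_add ρ _ _
        _ ≤ R + δ⁻¹ * R * M := by
          gcongr
          exact hM m hmN
        _ = (1 + M / δ) * R := by rw [div_eq_mul_inv]; ring

/-- The hat coordinates are Lipschitz functions on the cone over a polygonal path. -/
theorem exists_abs_hat_coord_sub_le (ρ : Seminorm ℝ X) {y : ℕ → X} {δ M : ℝ} (hδ : 0 < δ)
    (hM : ∀ n, ρ (y n) ≤ M)
    (hy : ∀ n, ∀ c : ℕ → ℝ, δ ≤ ρ (y n - ∑ i ∈ Finset.range n, c i • y i)) :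
    ∃ K : ℝ, 0 ≤ K ∧ ∀ p ∈ coneSet, ∀ q ∈ coneSet, ∀ n,
      |p.1 * hat n p.2 - q.1 * hat n q.2| ≤
        K * ρ (p.1 • polygonal y p.2 - q.1 • polygonal y q.2) := by
  have hM0 : 0 ≤ M := (apply_nonneg ρ _).trans (hM 0)
  have hA : 1 ≤ 1 + M / δ := by
    have := div_nonneg hM0 hδ.le
    linarith
  refine ⟨δ⁻¹ * (1 + M / δ) ^ 4, by positivity, fun p hp q hq n => ?_⟩
  by_cases hn : n ∈ floorPair p.2 q.2
  · rw [smul_polygonal_sub y _ _ hp.2.2 hq.2.2]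
    refine (abs_coeff_le ρ hδ (N := (floorPair p.2 q.2).sup id + 1) (fun n _ => hM n)
      (fun n _ => hy n) (floorPair p.2 q.2)
      (fun i hi => Nat.lt_succ_of_le (Finset.le_sup (f := id) hi))
      (fun n => p.1 * hat n p.2 - q.1 * hat n q.2) n hn).trans ?_
    gcongr
    exact Finset.card_le_four
  · simp only [floorPair, Finset.mem_insert, Finset.mem_singleton, not_or] at hn
    rw [hat_eq_zero_of_ne hp.2.2 hn.1 hn.2.1, hat_eq_zero_of_ne hq.2.2 hn.2.2.1 hn.2.2.2]
    simp only [mul_zero, sub_zero, abs_zero]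
    positivity

theorem seminorm_polygonal_le (ρ : Seminorm ℝ X) {y : ℕ → X} {M : ℝ} (hM : ∀ n, ρ (y n) ≤ M)
    {s : ℝ} (hs : 0 ≤ s) : ρ (polygonal y s) ≤ M := by
  refine (map_add_le_add ρ _ _).trans ?_
  rw [ρ.map_smul_real, ρ.map_smul_real, abs_of_nonneg (hat_nonneg _ _),
    abs_of_nonneg (hat_nonneg _ _)]
  have h1 := mul_le_mul_of_nonneg_left (hM ⌊s⌋₊) (hat_nonneg ⌊s⌋₊ s)
  have h2 := mul_le_mul_of_nonneg_left (hM (⌊s⌋₊ + 1)) (hat_nonneg (⌊s⌋₊ + 1) s)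
  have e : hat ⌊s⌋₊ s + hat (⌊s⌋₊ + 1) s = 1 := by
    rw [hat_floor hs, hat_floor_add_one hs]; ring
  calc _ ≤ hat ⌊s⌋₊ s * M + hat (⌊s⌋₊ + 1) s * M := add_le_add h1 h2
    _ = M := by rw [← add_mul, e, one_mul]

theorem seminorm_polygonal_sub_le (ρ : Seminorm ℝ X) {y : ℕ → X} {M : ℝ}
    (hM : ∀ n, ρ (y n) ≤ M) {s t : ℝ} (hs : 0 ≤ s) (ht : 0 ≤ t) :
    ρ (polygonal y s - polygonal y t) ≤ 4 * M * min 1 |s - t| := by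
  have hM0 : 0 ≤ M := (apply_nonneg ρ _).trans (hM 0)
  rw [mul_min_of_nonneg _ _ (by positivity)]
  refine le_min ?_ ?_
  · have h1 := map_sub_le_add ρ (polygonal y s) (polygonal y t)
    have h2 := seminorm_polygonal_le ρ hM hs
    have h3 := seminorm_polygonal_le ρ hM ht
    linarith
  · have e := smul_polygonal_sub y 1 1 hs ht
    simp only [one_smul, one_mul] at e
    rw [e]
    calc ρ (∑ n ∈ floorPair s t, (hat n s - hat n t) • y n)
        ≤ ∑ n ∈ floorPair s t, ρ ((hat n s - hat n t) • y n) :=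
          Finset.le_sum_of_subadditive ρ (map_zero ρ).le (map_add_le_add ρ) _ _
      _ ≤ ∑ n ∈ floorPair s t, |s - t| * M := by
          refine Finset.sum_le_sum fun n _ => ?_
          rw [ρ.map_smul_real]
          exact mul_le_mul (abs_hat_sub_le n s t) (hM n) (apply_nonneg _ _) (abs_nonneg _)
      _ = (floorPair s t).card * (|s - t| * M) := by rw [Finset.sum_const, nsmul_eq_mul]
      _ ≤ 4 * (|s - t| * M) := by
          gcongr
          exact_mod_cast Finset.card_le_four
      _ = 4 * M * |s - t| := by ring

/-- No separation of the `y n` is needed in this direction, so it applies to every continuous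
seminorm and not only to `ρ₀`. -/
theorem seminorm_smul_polygonal_sub_le (ρ : Seminorm ℝ X) {y : ℕ → X} {M : ℝ}
    (hM : ∀ n, ρ (y n) ≤ M) {p q : ℝ × ℝ} (hp : p ∈ coneSet) (hq : q ∈ coneSet) :
    ρ (p.1 • polygonal y p.2 - q.1 • polygonal y q.2) ≤ 4 * M * coneDist p q := by
  wlog hpq : p.1 ≤ q.1 generalizing p q
  · rw [coneDist_comm, map_sub_rev]
    exact this hq hp (le_of_not_ge hpq)
  have hM0 : 0 ≤ M := (apply_nonneg ρ _).trans (hM 0)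
  have e : p.1 • polygonal y p.2 - q.1 • polygonal y q.2 =
      p.1 • (polygonal y p.2 - polygonal y q.2) + (p.1 - q.1) • polygonal y q.2 := by module
  have h1 := mul_le_mul_of_nonneg_left (seminorm_polygonal_sub_le ρ hM hp.2.2 hq.2.2) hp.1
  have h2 := mul_le_mul_of_nonneg_left (seminorm_polygonal_le ρ hM hq.2.2)
    (abs_nonneg (p.1 - q.1))
  rw [e]
  refine (map_add_le_add ρ _ _).trans ?_
  rw [ρ.map_smul_real, ρ.map_smul_real, abs_of_nonneg hp.1, coneDist, min_eq_left hpq]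
  have := mul_nonneg (abs_nonneg (p.1 - q.1)) hM0
  linarith

end Polygonal

/-! ### From weights on two consecutive integers to cone coordinates. -/

section Barycenter

/-- The total mass of a finitely supported weight on `ℕ`. -/
noncomputable def mass (a : ℕ → ℝ) : ℝ := ∑ᶠ n, a n

/-- The barycenter of a finitely supported weight on `ℕ`. -/
noncomputable def barycenter (a : ℕ → ℝ) : ℝ := (∑ᶠ n, a n * n) / mass a

/-- The weight `a` is nonnegative and carried by the two indices `N` and `N + 1`. -/
def CarriedByPair (a : ℕ → ℝ) (N : ℕ) : Prop :=
  (∀ n, 0 ≤ a n) ∧ ∀ n, n ≠ N → n ≠ N + 1 → a n = 0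

variable {a b : ℕ → ℝ} {N N' : ℕ}

theorem CarriedByPair.finsum_eq (h : CarriedByPair a N) {F : Finset ℕ} (h1 : N ∈ F)
    (h2 : N + 1 ∈ F) (g : ℕ → ℝ) : ∑ᶠ n, a n * g n = ∑ n ∈ F, a n * g n := by
  refine finsum_eq_sum_of_support_subset _ fun n hn => ?_
  by_contra hF
  refine hn ?_
  simp only
  rw [h.2 n (fun e => hF (by simpa [e] using h1)) (fun e => hF (by simpa [e] using h2)), zero_mul]

theorem CarriedByPair.mass_eq (h : CarriedByPair a N) {F : Finset ℕ} (h1 : N ∈ F)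
    (h2 : N + 1 ∈ F) : mass a = ∑ n ∈ F, a n := by
  simpa [mass] using h.finsum_eq h1 h2 (fun _ => 1)

theorem CarriedByPair.mass_pair (h : CarriedByPair a N) : mass a = a N + a (N + 1) := by
  rw [h.mass_eq (F := {N, N + 1}) (by simp) (by simp), Finset.sum_pair (by omega)]

theorem CarriedByPair.mass_nonneg (h : CarriedByPair a N) : 0 ≤ mass a := by
  rw [h.mass_pair]
  exact add_nonneg (h.1 _) (h.1 _)

theorem CarriedByPair.barycenter_nonneg (h : CarriedByPair a N) : 0 ≤ barycenter a :=
  div_nonneg (finsum_nonneg fun n => mul_nonneg (h.1 n) n.cast_nonneg) h.mass_nonneg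

theorem CarriedByPair.abs_mass_sub_le (ha : CarriedByPair a N) (hb : CarriedByPair b N') {κ : ℝ}
    (hκ : ∀ n, |a n - b n| ≤ κ) : |mass a - mass b| ≤ 4 * κ := by
  rw [ha.mass_eq (F := {N, N + 1, N', N' + 1}) (by simp) (by simp),
    hb.mass_eq (F := {N, N + 1, N', N' + 1}) (by simp) (by simp), ← Finset.sum_sub_distrib]
  refine (Finset.abs_sum_le_sum_abs _ _).trans ((Finset.sum_le_sum fun n _ => hκ n).trans ?_)
  rw [Finset.sum_const, nsmul_eq_mul]
  have : 0 ≤ κ := (abs_nonneg _).trans (hκ 0)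
  gcongr
  exact_mod_cast Finset.card_le_four

theorem CarriedByPair.barycenter_sub_le_aux (ha : CarriedByPair a N) (hb : CarriedByPair b N')
    (hN : N ≤ N') {κ : ℝ} (hκ : ∀ n, |a n - b n| ≤ κ) :
    min (mass a) (mass b) * min 1 |barycenter a - barycenter b| ≤ 9 * κ := by
  have hκ0 : 0 ≤ κ := (abs_nonneg _).trans (hκ 0)
  have ha0 := ha.mass_nonneg
  have hb0 := hb.mass_nonneg
  have hw0 : 0 ≤ min 1 |barycenter a - barycenter b| := le_min zero_le_one (abs_nonneg _)
  have hw1 : min 1 |barycenter a - barycenter b| ≤ 1 := min_le_left _ _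
  rcases le_or_gt (N + 2) N' with h | h
  -- The two pairs are disjoint, so `b` vanishes on the pair of `a` and `mass a ≤ 2 * κ`.
  · have h1 : a N ≤ κ := by
      have := hκ N
      rw [hb.2 N (by omega) (by omega), sub_zero] at this
      exact (le_abs_self _).trans this
    have h2 : a (N + 1) ≤ κ := by
      have := hκ (N + 1)
      rw [hb.2 (N + 1) (by omega) (by omega), sub_zero] at this
      exact (le_abs_self _).trans this
    have h3 := ha.mass_pair
    have h4 := min_le_left (mass a) (mass b)
    have h5 : 0 ≤ min (mass a) (mass b) := le_min ha0 hb0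
    nlinarith
  · have hF : N' = N ∨ N' = N + 1 := by omega
    have hb1 : N' ∈ ({N, N + 1, N + 2} : Finset ℕ) := by
      rcases hF with rfl | rfl <;> simp
    have hb2 : N' + 1 ∈ ({N, N + 1, N + 2} : Finset ℕ) := by
      rcases hF with rfl | rfl <;> simp
    have split : ∀ u : ℕ → ℝ, ∑ n ∈ ({N, N + 1, N + 2} : Finset ℕ), u n =
        u N + u (N + 1) + u (N + 2) := by
      intro u
      rw [Finset.sum_insert (by simp), Finset.sum_pair (by omega), add_assoc]
    have ma : mass a = a N + a (N + 1) + a (N + 2) := by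
      rw [ha.mass_eq (F := {N, N + 1, N + 2}) (by simp) (by simp), split]
    have mb : mass b = b N + b (N + 1) + b (N + 2) := by
      rw [hb.mass_eq hb1 hb2, split]
    have ba : barycenter a * mass a = N * mass a + (a (N + 1) + 2 * a (N + 2)) := by
      by_cases h0 : mass a = 0
      · rw [h0, mul_zero, mul_zero]
        have := ha.1 N; have := ha.1 (N + 1); have := ha.1 (N + 2)
        linarith
      · rw [barycenter, div_mul_cancel₀ _ h0,
          ha.finsum_eq (F := {N, N + 1, N + 2}) (by simp) (by simp), split, ma]
        push_cast
        ring
    have bb : barycenter b * mass b = N * mass b + (b (N + 1) + 2 * b (N + 2)) := by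
      by_cases h0 : mass b = 0
      · rw [h0, mul_zero, mul_zero]
        have := hb.1 N; have := hb.1 (N + 1); have := hb.1 (N + 2)
        linarith
      · rw [barycenter, div_mul_cancel₀ _ h0, hb.finsum_eq hb1 hb2, split, mb]
        push_cast
        ring
    by_cases h0 : mass b = 0
    · have : min (mass a) (mass b) = 0 := by rw [h0]; exact min_eq_right ha0
      rw [this, zero_mul]
      positivity
    have hbpos : 0 < mass b := lt_of_le_of_ne hb0 (Ne.symm h0)
    set t := barycenter b - N with ht
    have htb : t * mass b = b (N + 1) + 2 * b (N + 2) := by rw [ht, sub_mul, bb]; ring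
    have ht0 : 0 ≤ t := by
      by_contra hneg
      have := mul_neg_of_neg_of_pos (not_le.1 hneg) hbpos
      have := hb.1 (N + 1); have := hb.1 (N + 2)
      linarith
    have ht2 : t ≤ 2 := by
      by_contra hgt
      have := mul_lt_mul_of_pos_right (not_le.1 hgt) hbpos
      have := hb.1 N; have := hb.1 (N + 1)
      linarith
    -- The moment of `b` about its own barycenter is zero, so subtracting it leaves only the
    -- differences `a n - b n`, with lever arms of at most `2`.
    have e : mass a * (barycenter a - barycenter b) =
        (a N - b N) * (0 - t) + (a (N + 1) - b (N + 1)) * (1 - t) +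
          (a (N + 2) - b (N + 2)) * (2 - t) := by
      have : barycenter b = t + N := by rw [ht]; ring
      rw [this]
      linear_combination ba - t * ma + t * mb - htb
    have habs : mass a * |barycenter a - barycenter b| ≤ 9 * κ := by
      rw [← abs_of_nonneg ha0, ← abs_mul, e]
      have t0 : |0 - t| ≤ 2 := abs_le.2 ⟨by linarith, by linarith⟩
      have t1 : |1 - t| ≤ 1 := abs_le.2 ⟨by linarith, by linarith⟩
      have t2 : |2 - t| ≤ 2 := abs_le.2 ⟨by linarith, by linarith⟩
      refine (abs_add_three _ _ _).trans ?_
      rw [abs_mul, abs_mul, abs_mul]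
      have s0 := mul_le_mul (hκ N) t0 (abs_nonneg _) hκ0
      have s1 := mul_le_mul (hκ (N + 1)) t1 (abs_nonneg _) hκ0
      have s2 := mul_le_mul (hκ (N + 2)) t2 (abs_nonneg _) hκ0
      linarith
    exact (mul_le_mul (min_le_left _ _) (min_le_right _ _) hw0 ha0).trans habs

theorem CarriedByPair.barycenter_sub_le (ha : CarriedByPair a N) (hb : CarriedByPair b N')
    {κ : ℝ} (hκ : ∀ n, |a n - b n| ≤ κ) :
    min (mass a) (mass b) * min 1 |barycenter a - barycenter b| ≤ 9 * κ := by
  rcases le_total N N' with h | h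
  · exact ha.barycenter_sub_le_aux hb h hκ
  · rw [min_comm (mass a), abs_sub_comm]
    exact hb.barycenter_sub_le_aux ha h fun n => by rw [abs_sub_comm]; exact hκ n

/-- The cone coordinates of a weight on `ℕ` carried by a pair of consecutive indices. -/
noncomputable def weightToCone (a : ℕ → ℝ) : ℝ × ℝ := (min 1 (mass a), barycenter a)

theorem CarriedByPair.weightToCone_mem (h : CarriedByPair a N) : weightToCone a ∈ coneSet :=
  ⟨le_min zero_le_one h.mass_nonneg, min_le_left _ _, h.barycenter_nonneg⟩

theorem CarriedByPair.coneDist_weightToCone_le (ha : CarriedByPair a N) (hb : CarriedByPair b N')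
    {κ : ℝ} (hκ : ∀ n, |a n - b n| ≤ κ) :
    coneDist (weightToCone a) (weightToCone b) ≤ 13 * κ := by
  have h1 : |min 1 (mass a) - min 1 (mass b)| ≤ 4 * κ :=
    ((abs_min_sub_min_le_max _ _ _ _).trans (max_le (by simp) le_rfl)).trans
      (ha.abs_mass_sub_le hb hκ)
  have h2 := ha.barycenter_sub_le hb hκ
  have h3 : min (min 1 (mass a)) (min 1 (mass b)) * min 1 |barycenter a - barycenter b| ≤
      min (mass a) (mass b) * min 1 |barycenter a - barycenter b| :=
    mul_le_mul_of_nonneg_right (min_le_min (min_le_right _ _) (min_le_right _ _))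
      (le_min zero_le_one (abs_nonneg _))
  simp only [coneDist, weightToCone]
  linarith

theorem carriedByPair_hat {p : ℝ × ℝ} (hp : p ∈ coneSet) :
    CarriedByPair (fun n => p.1 * hat n p.2) ⌊p.2⌋₊ :=
  ⟨fun n => mul_nonneg hp.1 (hat_nonneg _ _), fun n h1 h2 => by
    simp only [hat_eq_zero_of_ne hp.2.2 h1 h2, mul_zero]⟩

/-- At the apex the mass is zero and the barycenter takes the default value `0`, so the position
along the ray is recovered only for `p.1 ≠ 0`. This suffices, because `coneDist` ignores that
position at the apex. -/
theorem weightToCone_hat {p : ℝ × ℝ} (hp : p ∈ coneSet) :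
    (weightToCone fun n => p.1 * hat n p.2).1 = p.1 ∧
      (p.1 ≠ 0 → (weightToCone fun n => p.1 * hat n p.2).2 = p.2) := by
  have h := carriedByPair_hat hp
  have hm : mass (fun n => p.1 * hat n p.2) = p.1 := by
    rw [h.mass_pair, hat_floor hp.2.2, hat_floor_add_one hp.2.2]; ring
  refine ⟨?_, fun h0 => ?_⟩
  · simp only [weightToCone, hm, min_eq_right hp.2.1]
  · simp only [weightToCone, barycenter, hm]
    rw [h.finsum_eq (F := {⌊p.2⌋₊, ⌊p.2⌋₊ + 1}) (by simp) (by simp), Finset.sum_pair (by omega),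
      hat_floor hp.2.2, hat_floor_add_one hp.2.2, div_eq_iff h0]
    push_cast
    ring

end Barycenter

/-! ### Lipschitz extension of the hat coordinates and the retraction onto the cone. -/

section Retraction

variable {X : Type u} [AddCommGroup X] [Module ℝ X]

/-- The smallest nonnegative extension of the `n`-th hat coordinate that is `K`-Lipschitz for the
seminorm `ρ`. -/
noncomputable def coordExt (ρ : Seminorm ℝ X) (y : ℕ → X) (K : ℝ) (x : X) (n : ℕ) : ℝ :=
  ⨆ p : coneSet, max 0 (p.1.1 * hat n p.1.2 - K * ρ (x - p.1.1 • polygonal y p.1.2))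

instance : Nonempty coneSet := ⟨⟨(0, 0), le_rfl, zero_le_one, le_rfl⟩⟩

variable {ρ : Seminorm ℝ X} {y : ℕ → X} {K : ℝ}

theorem coordExt_bddAbove (hK : 0 ≤ K) (x : X) (n : ℕ) : BddAbove (Set.range fun p : coneSet =>
    max 0 (p.1.1 * hat n p.1.2 - K * ρ (x - p.1.1 • polygonal y p.1.2))) := by
  refine ⟨1, ?_⟩
  rintro _ ⟨⟨p, hp⟩, rfl⟩
  refine max_le zero_le_one ?_
  have h1 : p.1 * hat n p.2 ≤ 1 := mul_le_one₀ hp.2.1 (hat_nonneg _ _) (hat_le_one _ _)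
  have h2 := mul_nonneg hK (apply_nonneg ρ (x - p.1 • polygonal y p.2))
  simp only
  linarith

theorem coordExt_nonneg (x : X) (n : ℕ) : 0 ≤ coordExt ρ y K x n :=
  Real.iSup_nonneg fun _ => le_max_left _ _

theorem coordExt_le_add (hK : 0 ≤ K) (x x' : X) (n : ℕ) :
    coordExt ρ y K x n ≤ coordExt ρ y K x' n + K * ρ (x - x') := by
  refine ciSup_le fun p => ?_
  have h := le_ciSup (coordExt_bddAbove (ρ := ρ) (y := y) hK x' n) p
  change _ ≤ coordExt ρ y K x' n at h
  have h0 := mul_nonneg hK (apply_nonneg ρ (x - x'))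
  refine max_le (add_nonneg (coordExt_nonneg _ _) h0) ?_
  have h1 := (le_max_right _ _).trans h
  have h2 := map_add_le_add ρ (x' - x) (x - p.1.1 • polygonal y p.1.2)
  rw [sub_add_sub_cancel, map_sub_rev ρ x' x] at h2
  have h3 := mul_le_mul_of_nonneg_left h2 hK
  linarith

theorem abs_coordExt_sub_le (hK : 0 ≤ K) (x x' : X) (n : ℕ) :
    |coordExt ρ y K x n - coordExt ρ y K x' n| ≤ K * ρ (x - x') := by
  have h1 := coordExt_le_add (ρ := ρ) (y := y) hK x x' n
  have h2 := coordExt_le_add (ρ := ρ) (y := y) hK x' x n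
  rw [map_sub_rev] at h2
  exact abs_le.2 ⟨by linarith, by linarith⟩

/-- The hat coordinates are `K / 2`-Lipschitz on the cone over the path through `y`. -/
def HatCoordLipschitz (ρ : Seminorm ℝ X) (y : ℕ → X) (K : ℝ) : Prop :=
  ∀ p ∈ coneSet, ∀ q ∈ coneSet, ∀ n, 2 * |p.1 * hat n p.2 - q.1 * hat n q.2| ≤
    K * ρ (p.1 • polygonal y p.2 - q.1 • polygonal y q.2)

theorem coordExt_smul_polygonal (hK : 0 ≤ K) (h : HatCoordLipschitz ρ y K) {q : ℝ × ℝ}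
    (hq : q ∈ coneSet) (n : ℕ) :
    coordExt ρ y K (q.1 • polygonal y q.2) n = q.1 * hat n q.2 := by
  refine le_antisymm (ciSup_le fun p => max_le (mul_nonneg hq.1 (hat_nonneg _ _)) ?_) ?_
  · have h1 := h p.1 p.2 q hq n
    rw [map_sub_rev] at h1
    have h2 := abs_nonneg (p.1.1 * hat n p.1.2 - q.1 * hat n q.2)
    have h3 := le_abs_self (p.1.1 * hat n p.1.2 - q.1 * hat n q.2)
    linarith
  · refine le_trans ?_ (le_ciSup (coordExt_bddAbove hK _ n) ⟨q, hq⟩)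
    simp

theorem exists_pos_of_coordExt_ne_zero {x : X} {n : ℕ} (h : coordExt ρ y K x n ≠ 0) :
    ∃ p ∈ coneSet, 0 < p.1 * hat n p.2 - K * ρ (x - p.1 • polygonal y p.2) := by
  by_contra! hcon
  refine h (le_antisymm (ciSup_le fun p => max_le le_rfl (hcon p.1 p.2)) (coordExt_nonneg _ _))

theorem hat_pos_of_sub_pos (hK : 0 ≤ K) {x : X} {n : ℕ} {p : ℝ × ℝ} (hp : p ∈ coneSet)
    (h : 0 < p.1 * hat n p.2 - K * ρ (x - p.1 • polygonal y p.2)) : |p.2 - n| < 1 := by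
  apply abs_sub_lt_one_of_hat_pos
  have h1 := mul_nonneg hK (apply_nonneg ρ (x - p.1 • polygonal y p.2))
  exact pos_of_mul_pos_right (by linarith) hp.1

/-- If both values were positive, witnesses `p` and `q` would have coordinates `u` and `v` exceeding
`K` times their `ρ`-distances to `x`. Each coordinate vanishes at the other witness, so the factor
`2` in `HatCoordLipschitz` bounds both `2 * u` and `2 * v` by `K` times the distance between the
witnesses. Averaging contradicts the triangle inequality. -/
theorem coordExt_eq_zero_of_far (hK : 0 ≤ K) (h : HatCoordLipschitz ρ y K) {x : X} {n m : ℕ}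
    (hnm : n + 2 ≤ m) (hn : coordExt ρ y K x n ≠ 0) : coordExt ρ y K x m = 0 := by
  by_contra hm
  obtain ⟨p, hp, hp0⟩ := exists_pos_of_coordExt_ne_zero hn
  obtain ⟨q, hq, hq0⟩ := exists_pos_of_coordExt_ne_zero hm
  have h1 := abs_lt.1 (hat_pos_of_sub_pos hK hp hp0)
  have h2 := abs_lt.1 (hat_pos_of_sub_pos hK hq hq0)
  have h3 : (n : ℝ) + 2 ≤ m := by exact_mod_cast hnm
  have e1 : hat n q.2 = 0 := hat_eq_zero ((by linarith : 1 ≤ q.2 - n).trans (le_abs_self _))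
  have e2 : hat m p.2 = 0 := hat_eq_zero ((by linarith : 1 ≤ -(p.2 - m)).trans (neg_le_abs _))
  have h4 := h p hp q hq n
  have h5 := h p hp q hq m
  rw [e1, mul_zero, sub_zero] at h4
  rw [e2, mul_zero, zero_sub, abs_neg] at h5
  have h6 := le_abs_self (p.1 * hat n p.2)
  have h7 := le_abs_self (q.1 * hat m q.2)
  have h8 := map_sub_le_add ρ (x - q.1 • polygonal y q.2) (x - p.1 • polygonal y p.2)
  rw [sub_sub_sub_cancel_left] at h8
  have h9 := mul_le_mul_of_nonneg_left h8 hK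
  linarith

theorem exists_carriedByPair_coordExt (hK : 0 ≤ K) (h : HatCoordLipschitz ρ y K) (x : X) :
    ∃ N, CarriedByPair (coordExt ρ y K x) N := by
  classical
  by_cases hex : ∃ n, coordExt ρ y K x n ≠ 0
  · refine ⟨Nat.find hex, coordExt_nonneg x, fun n h1 h2 => ?_⟩
    rcases lt_or_gt_of_ne h1 with hlt | hgt
    · exact not_not.1 (Nat.find_min hex hlt)
    · exact coordExt_eq_zero_of_far hK h (by omega) (Nat.find_spec hex)
  · push Not at hex
    exact ⟨0, coordExt_nonneg x, fun n _ _ => hex n⟩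

/-- The cone over a polygonal path with Lipschitz hat coordinates carries a `ρ`-Lipschitz
self-map (in cone coordinates, on the whole space) without approximate fixed points. -/
theorem exists_cone_selfmap (hK : 0 ≤ K) (h : HatCoordLipschitz ρ y K) :
    ∃ g : X → ℝ × ℝ, (∀ x, g x ∈ coneSet) ∧
      (∀ x x', coneDist (g x) (g x') ≤ 156 * (K * ρ (x - x'))) ∧
      ∀ x, 1 / 64 ≤ 13 * (K * ρ (x - (g x).1 • polygonal y (g x).2)) := by
  choose N hN using exists_carriedByPair_coordExt hK h
  have hmem : ∀ x, weightToCone (coordExt ρ y K x) ∈ coneSet := fun x => (hN x).weightToCone_mem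
  have hlip : ∀ x x', coneDist (weightToCone (coordExt ρ y K x))
      (weightToCone (coordExt ρ y K x')) ≤ 13 * (K * ρ (x - x')) := fun x x' =>
    (hN x).coneDist_weightToCone_le (hN x') (abs_coordExt_sub_le hK x x')
  refine ⟨fun x => coneMap (weightToCone (coordExt ρ y K x)), fun x => coneMap_mem (hmem x),
    fun x x' => ?_, fun x => ?_⟩
  · have h1 := coneDist_coneMap_le (hmem x) (hmem x')
    have h2 := hlip x x'
    linarith
  · simp only
    set q := coneMap (weightToCone (coordExt ρ y K x)) with hq
    have hqm : q ∈ coneSet := coneMap_mem (hmem x)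
    -- The Lipschitz bound is applied to `x` and its image point, whose retracted coordinates are
    -- again `q`, up to the irrelevant position at the apex.
    refine (coneDist_coneMap_ge (hmem x)).trans (le_trans (le_of_eq ?_) (hlip x _))
    rw [← hq, funext (coordExt_smul_polygonal hK h hqm)]
    obtain ⟨e1, e2⟩ := weightToCone_hat hqm
    simp only [coneDist, e1]
    by_cases h0 : q.1 = 0
    · rw [h0, min_eq_right (hmem x).1, zero_mul, zero_mul]
    · rw [e2 h0]

end Retraction

/-! ### Construction of the separated sequence. -/

section Separated

variable {X : Type u} [AddCommGroup X] [Module ℝ X]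

/-- Otherwise every point of `C - x₀` is within `δ` of a combination of the first `N` vectors. By
`abs_coeff_le` the coefficients stay in a compact ball of `ℝ^N`; a finite net there costs another
`δ` and yields a finite cover of `C` by balls of radius `2 * δ`. -/
theorem exists_separated_extension (ρ : Seminorm ℝ X) {C : Set X} {x₀ : X} {δ M : ℝ} (hδ : 0 < δ)
    (hM : ∀ x ∈ C, ρ (x - x₀) ≤ M) (hM0 : 0 ≤ M)
    (hC : ∀ t : Set X, t.Finite → ¬ C ⊆ ⋃ z ∈ t, ρ.ball z (2 * δ)) (N : ℕ) {y : ℕ → X}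
    (hyC : ∀ n < N, x₀ + y n ∈ C)
    (hy : ∀ n < N, ∀ c : ℕ → ℝ, δ ≤ ρ (y n - ∑ i ∈ Finset.range n, c i • y i)) :
    ∃ z, x₀ + z ∈ C ∧ ∀ c : ℕ → ℝ, δ ≤ ρ (z - ∑ i ∈ Finset.range N, c i • y i) := by
  by_contra! hcon
  have hyM : ∀ n < N, ρ (y n) ≤ M := fun n hn => by simpa using hM _ (hyC n hn)
  set B := δ⁻¹ * (1 + M / δ) ^ N * (M + δ) with hB
  -- With this mesh, the `N` coefficient errors, each multiplied by a vector of seminorm at most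
  -- `M`, add up to at most `δ`; the `+ 1` covers `N * M = 0`.
  have he : 0 < δ / (N * M + 1) := by positivity
  obtain ⟨t, -, htf, ht⟩ :=
    (isCompact_closedBall (0 : Fin N → ℝ) B).finite_cover_balls he
  refine hC ((fun c : Fin N → ℝ => x₀ + ∑ i, c i • y i) '' t) (htf.image _) fun x hx => ?_
  obtain ⟨c, hc⟩ := hcon (x - x₀) (by simpa using hx)
  have hsum : ρ (∑ i ∈ Finset.range N, c i • y i) ≤ M + δ := by
    have h := map_sub_le_add ρ (x - x₀) (x - x₀ - ∑ i ∈ Finset.range N, c i • y i)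
    rw [sub_sub_cancel] at h
    linarith [hM x hx]
  have hcB : (fun i : Fin N => c i) ∈ Metric.closedBall (0 : Fin N → ℝ) B := by
    rw [mem_closedBall_zero_iff, pi_norm_le_iff_of_nonneg (by positivity)]
    intro i
    have h := abs_coeff_le ρ hδ hyM hy (Finset.range N) (fun n hn => Finset.mem_range.1 hn) c i
      (Finset.mem_range.2 i.2)
    rw [Finset.card_range] at h
    rw [Real.norm_eq_abs, hB]
    exact h.trans (mul_le_mul_of_nonneg_left hsum (by positivity))
  obtain ⟨c', hc't, hc'⟩ := Set.mem_iUnion₂.1 (ht hcB)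
  refine Set.mem_iUnion₂.2 ⟨_, Set.mem_image_of_mem _ hc't, ?_⟩
  rw [Seminorm.mem_ball]
  have e : x - (x₀ + ∑ i, c' i • y i) = (x - x₀ - ∑ i ∈ Finset.range N, c i • y i) +
      ∑ i : Fin N, (c i - c' i) • y i := by
    simp only [sub_smul, Finset.sum_sub_distrib]
    rw [Finset.sum_range]
    abel
  rw [e]
  refine (map_add_le_add ρ _ _).trans_lt ?_
  have h2 : ρ (∑ i : Fin N, (c i - c' i) • y i) ≤ δ := by
    calc ρ (∑ i : Fin N, (c i - c' i) • y i)
        ≤ ∑ i : Fin N, ρ ((c i - c' i) • y i) :=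
          Finset.le_sum_of_subadditive ρ (map_zero ρ).le (map_add_le_add ρ) _ _
      _ ≤ ∑ _i : Fin N, δ / (N * M + 1) * M := by
          refine Finset.sum_le_sum fun i _ => ?_
          rw [ρ.map_smul_real]
          refine mul_le_mul ?_ (hyM i i.2) (apply_nonneg _ _) he.le
          have := dist_le_pi_dist (fun i : Fin N => c i) c' i
          rw [Real.dist_eq] at this
          exact this.trans (Metric.mem_ball.1 hc').le
      _ = δ * ((N * M) / (N * M + 1)) := by
          rw [Finset.sum_const, Finset.card_univ, Fintype.card_fin, nsmul_eq_mul]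
          ring
      _ ≤ δ := mul_le_of_le_one_right hδ.le
          ((div_le_one (by positivity)).2 (by linarith))
  linarith

theorem exists_separated_seq (ρ : Seminorm ℝ X) {C : Set X} {x₀ : X} {δ M : ℝ} (hδ : 0 < δ)
    (hM : ∀ x ∈ C, ρ (x - x₀) ≤ M) (hM0 : 0 ≤ M)
    (hC : ∀ t : Set X, t.Finite → ¬ C ⊆ ⋃ z ∈ t, ρ.ball z (2 * δ)) :
    ∃ y : ℕ → X, (∀ n, x₀ + y n ∈ C) ∧
      ∀ n, ∀ c : ℕ → ℝ, δ ≤ ρ (y n - ∑ i ∈ Finset.range n, c i • y i) := by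
  classical
  let good : ℕ → (ℕ → X) → X → Prop := fun n y z =>
    x₀ + z ∈ C ∧ ∀ c : ℕ → ℝ, δ ≤ ρ (z - ∑ i ∈ Finset.range n, c i • y i)
  -- `good n` sees only the values below `n`, so the default `0` used for the other indices in the
  -- recursion does no harm.
  have hcongr : ∀ n y y', (∀ i < n, y i = y' i) → ∀ z, good n y z → good n y' z := by
    intro n y y' hyy z hz
    refine ⟨hz.1, fun c => ?_⟩
    have e : ∑ i ∈ Finset.range n, c i • y' i = ∑ i ∈ Finset.range n, c i • y i :=
      Finset.sum_congr rfl fun i hi => by rw [hyy i (Finset.mem_range.1 hi)]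
    rw [e]
    exact hz.2 c
  let step : ∀ n : ℕ, (∀ m, m < n → X) → X := fun n prev =>
    Classical.epsilon (good n fun i => if h : i < n then prev i h else 0)
  let y : ℕ → X := fun n => Nat.strongRec (motive := fun _ => X) step n
  have hy : ∀ n, y n = Classical.epsilon (good n fun i => if i < n then y i else 0) := by
    intro n
    change Nat.strongRec (motive := fun _ => X) step n = _
    rw [Nat.strongRec_eq]
    simp only [step, y, dite_eq_ite]
  have key : ∀ n, good n y (y n) := by
    intro n
    induction n using Nat.strong_induction_on with
    | _ n ih =>
      obtain ⟨z, hz⟩ := exists_separated_extension ρ hδ hM hM0 hC n (fun m hm => (ih m hm).1)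
        (fun m hm => (ih m hm).2)
      have h1 := Classical.epsilon_spec (p := good n fun i => if i < n then y i else 0)
        ⟨z, hcongr n y _ (fun i hi => by simp [hi]) z hz⟩
      rw [← hy n] at h1
      exact hcongr n _ y (fun i hi => by simp [hi]) _ h1
  exact ⟨y, fun n => (key n).1, fun n => (key n).2⟩

end Separated

/-! ### Boundedness in every continuous seminorm, and assembly. -/

theorem Bornology.IsVonNBounded.exists_seminorm_le {𝕜 : Type v} {X : Type u} [RCLike 𝕜]
    [AddCommGroup X] [Module 𝕜 X] [TopologicalSpace X] {C : Set X}
    (hC : Bornology.IsVonNBounded 𝕜 C) {ρ : Seminorm 𝕜 X} (hρ : Continuous ρ) :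
    ∃ M : ℝ, 0 ≤ M ∧ ∀ x ∈ C, ρ x ≤ M := by
  obtain ⟨r, hr, h⟩ := (hC (Seminorm.ball_mem_nhds hρ one_pos)).exists_pos
  refine ⟨r, hr.le, fun x hx => ?_⟩
  have hn : ‖(r : 𝕜)‖ = r := by rw [RCLike.norm_ofReal, abs_of_pos hr]
  obtain ⟨z, hz, rfl⟩ := h (r : 𝕜) hn.ge hx
  rw [Seminorm.mem_ball_zero] at hz
  simp only [map_smul_eq_mul, hn]
  exact mul_le_of_le_one_right hr.le hz.le

theorem mainTheorem4 {𝕜 : Type v} {X : Type u} [RCLike 𝕜] [AddCommGroup X] [Module 𝕜 X]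
    [Module ℝ X] [IsScalarTower ℝ 𝕜 X] [TopologicalSpace X] [IsTopologicalAddGroup X]
    [ContinuousSMul 𝕜 X] [LocallyConvexSpace ℝ X]
    (C : Set X) (hconv : Convex ℝ C) (hbdd : Bornology.IsVonNBounded 𝕜 C)
    (ρ₀ : Seminorm 𝕜 X) (hρ₀ : Continuous ρ₀) (hC : ¬ SeminormTotallyBounded ρ₀ C) :
    ∃ f : C → C, ¬ HasApproxFixedPointNet f ∧
      ∀ ρ : Seminorm 𝕜 X, Continuous ρ → SeminormLipschitz ρ₀ ρ f := by
  unfold SeminormTotallyBounded at hC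
  push Not at hC
  obtain ⟨ε, hε, hcov⟩ := hC
  obtain ⟨x₀, hx₀⟩ : C.Nonempty := by
    by_contra h
    rw [Set.not_nonempty_iff_eq_empty] at h
    exact hcov ∅ Set.finite_empty (by simp [h])
  have hbound : ∀ ρ : Seminorm 𝕜 X, Continuous ρ → ∃ M : ℝ, 0 ≤ M ∧ ∀ x ∈ C, ρ (x - x₀) ≤ M := by
    intro ρ hρ
    obtain ⟨M, hM0, hM⟩ := hbdd.exists_seminorm_le hρ
    refine ⟨M + M, by positivity, fun x hx => (map_sub_le_add ρ _ _).trans ?_⟩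
    exact add_le_add (hM x hx) (hM x₀ hx₀)
  obtain ⟨M, hM0, hM⟩ := hbound ρ₀ hρ₀
  obtain ⟨y, hyC, hy⟩ := exists_separated_seq (ρ₀.restrictScalars ℝ) (half_pos hε) hM hM0
    (fun t ht h => hcov t ht (by rwa [mul_div_cancel₀ _ (two_ne_zero' ℝ)] at h))
  have hyM : ∀ ρ : Seminorm 𝕜 X, ∀ M : ℝ, (∀ x ∈ C, ρ (x - x₀) ≤ M) → ∀ n, ρ (y n) ≤ M :=
    fun ρ M h n => by simpa using h _ (hyC n)
  obtain ⟨K, hK, hlip⟩ := exists_abs_hat_coord_sub_le (ρ₀.restrictScalars ℝ) (half_pos hε)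
    (hyM ρ₀ M hM) hy
  -- The constant is doubled to meet the factor `2` in `HatCoordLipschitz`.
  obtain ⟨g, hg, hgL, hgd⟩ := exists_cone_selfmap (ρ := ρ₀.restrictScalars ℝ) (y := y)
    (K := 2 * K) (by positivity) (fun p hp q hq n => by
      rw [mul_assoc]
      exact mul_le_mul_of_nonneg_left (hlip p hp q hq n) zero_le_two)
  refine ⟨fun x => ⟨x₀ + (g (x - x₀)).1 • polygonal y (g (x - x₀)).2,
    add_smul_polygonal_mem hconv hx₀ hyC (hg _)⟩, ?_, ?_⟩
  · rintro ⟨ι, _, _, _, x, hx⟩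
    -- Continuity of `ρ₀` alone excludes the net: `ρ₀ (x i - f (x i))` would tend to `0`, against
    -- the uniform lower bound `hgd`.
    have h1 := (hρ₀.tendsto 0).comp hx
    rw [map_zero] at h1
    have h2 := (h1.const_mul (2 * K)).const_mul 13
    rw [mul_zero, mul_zero] at h2
    refine absurd (ge_of_tendsto h2 (b := 1 / 64) (Eventually.of_forall fun i => ?_)) (by norm_num)
    have := hgd (x i - x₀)
    simpa only [Function.comp, sub_sub, Seminorm.coe_restrictScalars] using this
  · intro ρ hρ
    obtain ⟨M', hM'0, hM'⟩ := hbound ρ hρ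
    refine ⟨4 * M' * (156 * (2 * K)), by positivity, fun a b => ?_⟩
    have h1 := seminorm_smul_polygonal_sub_le (ρ.restrictScalars ℝ) (hyM ρ M' hM')
      (hg (a - x₀)) (hg (b - x₀))
    have h2 := hgL (a - x₀) (b - x₀)
    rw [sub_sub_sub_cancel_right] at h2
    simp only [add_sub_add_left_eq_sub, Seminorm.coe_restrictScalars] at h1 h2 ⊢
    refine h1.trans ((mul_le_mul_of_nonneg_left h2 (by positivity)).trans (le_of_eq ?_))
    ring
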